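/- Let $\mathcal M$ be a closed (compact, boundaryless) smooth manifold, $F=(F_1,\dots,F_d):\mathcal M\to\mathbb R^d$ a $C^\infty$ embedding, $\mathfrak g$ the Riemannian metric induced by $F$, i.e. $\mathfrak g_x(u,v)=F_{*x}u\cdot F_{*x}v$, and $\nu$ its Riemannian volume measure. Let $\nabla$ be the gradient of $\mathfrak g$ and $\Delta=-\operatorname{div}\circ\nabla$ the Laplace–Beltrami operator, where $h=\operatorname{div}W$ is the function with $\int f h\,d\nu=-\int\langle\nabla f,W\rangle_{\mathfrak g}\,d\nu$ for all $f\in C^1(\mathcal M)$ (so $\Delta$ is understood weakly). For a continuous vector field $W$ put $\|W\|_{\mathbb H}=\big(\int\|W(x)\|^2_{\mathfrak g(x)}\,d\nu(x)\big)^{1/2}$, and for $f\in C^1(\mathcal M;\mathbb R^d)$ put $$|f|_{1,2}=\sum_{j=1}^d\|\nabla f_j\|_{\mathbb H},\qquad |f|_{2,\infty}=\sum_{j=1}^d\|\Delta f_j\|_{L^\infty(\nu)}\in[0,\infty],\qquad \|f\|_{L^1(\nu;\mathbb R^d)}=\sum_{j=1}^d\int|f_j|\,d\nu ,$$ where $\|\Delta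 f_j\|_{L^\infty(\nu)}=\infty$ if $\Delta f_j$ is not an $L^\infty$ function. Let $V,\hat V$ be continuous vector fields on $\mathcal M$ generating flows $\Phi^t,\hat\Phi^t:\mathcal M\to\mathcal M$, $t\in\mathbb R$, that is, continuous flows all of whose orbits are integral curves of $V$, respectively $\hat V$. Fix $T>0$ and assume that $F\circ\Phi^t$ and $F\circ\hat\Phi^t$ are of class $C^1$ for every $t\in[0,T]$ and that the two suprema in $$\alpha=\|V-\hat V\|_{\mathbb H}\,\sup_{t\in[0,T]}|F\circ\Phi^t|_{1,2},\qquad \beta=\|\hat V\|_{\mathbb H}\,\Big(\sup_{t\in[0,T]}|F\circ\Phi^t-F\circ\hat\Phi^t|_{2,\infty}\Big)^{1/2}$$ are finite. Then for every $t\in[0,T]$ the error $\varepsilon(t)=\|F\circ\Phi^t-F\circ\hat\Phi^t\|_{L^1(\nu;\mathbb R^d)}$ has a right derivative $\dot\varepsilon(t)$ at $t$, and $$\dot\varepsilon(t)\le\alpha+\beta\sqrt{\varepsilon(t)},\qquad \varepsilon(t)\le t\Big(\sqrt\alpha+\frac{\beta\sqrt t}{2}\Big)^2 .$$ -/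

import Mathlib

open MeasureTheory Set Manifold
open scoped ContDiff ENNReal

namespace OrbitError

noncomputable section

variable {m d : ℕ} {M : Type*} [TopologicalSpace M] [ChartedSpace (EuclideanSpace ℝ (Fin m)) M]

/-- The pushforward `F_{*x} : T_x M → ℝ^d` of tangent vectors. -/
def pushforward (F : M → EuclideanSpace ℝ (Fin d)) (x : M) :
    TangentSpace (𝓡 m) x →L[ℝ] EuclideanSpace ℝ (Fin d) :=
  mfderiv (𝓡 m) 𝓘(ℝ, EuclideanSpace ℝ (Fin d)) F x

/-- The differential `df_x : T_x M → ℝ` of a real function. -/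
def differential (f : M → ℝ) (x : M) : TangentSpace (𝓡 m) x →L[ℝ] ℝ :=
  mfderiv (𝓡 m) 𝓘(ℝ, ℝ) f x

/-- The Riemannian metric induced by `F`: `g_x(u, v) = F_{*x} u ⬝ F_{*x} v`. -/
def metric (F : M → EuclideanSpace ℝ (Fin d)) (x : M) (u v : TangentSpace (𝓡 m) x) : ℝ :=
  inner ℝ (pushforward F x u) (pushforward F x v)

open Classical in
/-- The Riemannian gradient: `∇f(x)` is the vector with `g_x(∇f(x), v) = df_x(v)` for all `v`
(it exists and is unique when `F` is an immersion, see the two lemmas below). -/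
def gradient (F : M → EuclideanSpace ℝ (Fin d)) (f : M → ℝ) (x : M) : TangentSpace (𝓡 m) x :=
  if h : ∃ w : TangentSpace (𝓡 m) x, ∀ v, metric F x w v = differential f x v
  then h.choose else 0

theorem metric_gradient (F : M → EuclideanSpace ℝ (Fin d)) (f : M → ℝ) (x : M)
    (hF : Function.Injective (pushforward (m := m) F x)) (v : TangentSpace (𝓡 m) x) :
    metric F x (gradient F f x) v = differential f x v := by
  have h : ∃ w : TangentSpace (𝓡 m) x, ∀ v, metric F x w v = differential f x v := by
    obtain ⟨l, hl⟩ := LinearMap.exists_leftInverse_of_injective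
      (pushforward (m := m) F x).toLinearMap (LinearMap.ker_eq_bot.2 hF)
    let φ : EuclideanSpace ℝ (Fin d) →ₗ[ℝ] ℝ := (differential f x).toLinearMap ∘ₗ l
    let z := (InnerProductSpace.toDual ℝ (EuclideanSpace ℝ (Fin d))).symm φ.toContinuousLinearMap
    let K : Submodule ℝ (EuclideanSpace ℝ (Fin d)) :=
      LinearMap.range (pushforward (m := m) F x).toLinearMap
    obtain ⟨w, hw⟩ := (K.orthogonalProjectionOnto z).2
    refine ⟨w, fun v => ?_⟩
    have hw' : pushforward F x w = (K.orthogonalProjectionOnto z : EuclideanSpace ℝ (Fin d)) := hw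
    have hv : pushforward F x v ∈ K := ⟨v, rfl⟩
    have h1 : l (pushforward F x v) = v := LinearMap.congr_fun hl v
    have h2 := K.inner_orthogonalProjectionOnto_eq_of_mem_right ⟨_, hv⟩ z
    have h3 : inner ℝ z (pushforward F x v) = φ (pushforward F x v) := by
      simp only [z, InnerProductSpace.toDual_symm_apply, LinearMap.coe_toContinuousLinearMap']
    rw [metric, hw']
    have h4 : φ (pushforward F x v) = differential f x v := by
      change differential f x (l (pushforward F x v)) = _
      rw [h1]
    rw [← h4, ← h3, ← h2]
    rfl
  rw [gradient, dif_pos h]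
  exact h.choose_spec v

theorem gradient_unique (F : M → EuclideanSpace ℝ (Fin d)) (f : M → ℝ) (x : M)
    (hF : Function.Injective (pushforward (m := m) F x)) (w : TangentSpace (𝓡 m) x)
    (hw : ∀ v, metric F x w v = differential f x v) : w = gradient F f x := by
  have h : metric F x (w - gradient F f x) (w - gradient F f x) = 0 := by
    have h1 := hw (w - gradient F f x)
    have h2 := metric_gradient F f x hF (w - gradient F f x)
    rw [metric] at h1 h2 ⊢
    rw [map_sub, inner_sub_left, ← map_sub, h1, h2, sub_self]
  rw [metric, inner_self_eq_zero] at h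
  exact sub_eq_zero.1 (hF (h.trans (map_zero _).symm))

variable [MeasurableSpace M]

/-- The Riemannian volume measure of the metric induced by the embedding `F`: the `m`-dimensional
Hausdorff measure of the submanifold `F(M)`, normalised to agree with Lebesgue measure on
`m`-dimensional Euclidean spaces, carried back to `M`. -/
def riemannianVolume (F : M → EuclideanSpace ℝ (Fin d)) : Measure M :=
  Measure.comap F (μHE[m] : Measure (EuclideanSpace ℝ (Fin d)))

/-- The measure `ν`; the dimension `m` is explicit. -/
local notation "ν[" m ", " F "]" => riemannianVolume (m := m) F

/-- `h = div W`, through `∫ f div W dν = - ∫ g(∇f, W) dν` for all `C¹` functions `f`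
(this determines `h` up to `ν`-null sets). -/
def IsDivergence (F : M → EuclideanSpace ℝ (Fin d)) (W : (x : M) → TangentSpace (𝓡 m) x)
    (h : M → ℝ) : Prop :=
  Integrable h (ν[m, F]) ∧ ∀ f : M → ℝ, ContMDiff (𝓡 m) 𝓘(ℝ, ℝ) 1 f →
    ∫ x, f x * h x ∂(ν[m, F]) = - ∫ x, metric F x (gradient F f x) (W x) ∂(ν[m, F])

/-- `h = Δ f` with `Δ = - div ∘ ∇` (positive Laplacian). -/
def IsLaplacian (m : ℕ) [ChartedSpace (EuclideanSpace ℝ (Fin m)) M]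
    (F : M → EuclideanSpace ℝ (Fin d)) (f h : M → ℝ) : Prop :=
  ContMDiff (𝓡 m) 𝓘(ℝ, ℝ) 1 f ∧ IsDivergence (m := m) F (gradient F f) (fun x => - h x)

/-- `‖Δ f‖_{L^∞(ν)}`, infinite when `Δ f` is not an `L^∞` function. As `Δ f` is determined
`ν`-almost everywhere, the infimum is over a single value (or none). -/
def laplacianSupNorm (m : ℕ) [ChartedSpace (EuclideanSpace ℝ (Fin m)) M]
    (F : M → EuclideanSpace ℝ (Fin d)) (f : M → ℝ) : ℝ≥0∞ :=
  ⨅ (h : M → ℝ) (_ : IsLaplacian m F f h), eLpNorm h ∞ (ν[m, F])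

/-- The Hodge norm `‖W‖_ℍ = (∫ g(W, W) dν)^{1/2}`. -/
def hodgeNorm (F : M → EuclideanSpace ℝ (Fin d)) (W : (x : M) → TangentSpace (𝓡 m) x) : ℝ≥0∞ :=
  (∫⁻ x, ENNReal.ofReal (metric F x (W x) (W x)) ∂(ν[m, F])) ^ (1 / 2 : ℝ)

/-- `|f|_{1,2} = ∑_j ‖∇ f_j‖_ℍ`. -/
def seminormOneTwo (m : ℕ) [ChartedSpace (EuclideanSpace ℝ (Fin m)) M]
    (F f : M → EuclideanSpace ℝ (Fin d)) : ℝ≥0∞ :=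
  ∑ j : Fin d, hodgeNorm (m := m) F (gradient F (fun x => f x j))

/-- `|f|_{2,∞} = ∑_j ‖Δ f_j‖_{L^∞(ν)}`. -/
def seminormTwoInfty (m : ℕ) [ChartedSpace (EuclideanSpace ℝ (Fin m)) M]
    (F f : M → EuclideanSpace ℝ (Fin d)) : ℝ≥0∞ :=
  ∑ j : Fin d, laplacianSupNorm m F (fun x => f x j)

/-- The vector field `W` is continuous, as a section of the tangent bundle. -/
def IsContinuousField [IsManifold (𝓡 m) 1 M] (W : (x : M) → TangentSpace (𝓡 m) x) : Prop :=
  Continuous fun x => (⟨x, W x⟩ : TangentBundle (𝓡 m) M)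

/-- The vector field `W` generates the flow `Φ`: all orbits are integral curves of `W`. -/
def Generates (W : (x : M) → TangentSpace (𝓡 m) x) (Φ : Flow ℝ M) : Prop :=
  ∀ x : M, IsMIntegralCurve (I := 𝓡 m) (fun t : ℝ => Φ t x) W

/-- `max_{t ∈ [0,T]} |F ∘ Φ^t|_{1,2}`, as a supremum. -/
def maxOneTwo (m : ℕ) [ChartedSpace (EuclideanSpace ℝ (Fin m)) M]
    (F : M → EuclideanSpace ℝ (Fin d)) (Φ : Flow ℝ M) (T : ℝ) : ℝ≥0∞ :=
  ⨆ t ∈ Icc (0 : ℝ) T, seminormOneTwo m F (fun x => F (Φ t x))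

/-- `max_{t ∈ [0,T]} |F ∘ Φ^t - F ∘ Φ'^t|_{2,∞}`, as a supremum. -/
def maxTwoInfty (m : ℕ) [ChartedSpace (EuclideanSpace ℝ (Fin m)) M]
    (F : M → EuclideanSpace ℝ (Fin d)) (Φ Φ' : Flow ℝ M) (T : ℝ) : ℝ≥0∞ :=
  ⨆ t ∈ Icc (0 : ℝ) T, seminormTwoInfty m F (fun x => F (Φ t x) - F (Φ' t x))

/-- `α = ‖V - V'‖_ℍ max_{t ∈ [0,T]} |F ∘ Φ^t|_{1,2}`. -/
def alpha (F : M → EuclideanSpace ℝ (Fin d)) (V V' : (x : M) → TangentSpace (𝓡 m) x)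
    (Φ : Flow ℝ M) (T : ℝ) : ℝ :=
  (hodgeNorm F (V - V')).toReal * (maxOneTwo m F Φ T).toReal

/-- `β = ‖V'‖_ℍ (max_{t ∈ [0,T]} |F ∘ Φ^t - F ∘ Φ'^t|_{2,∞})^{1/2}`. -/
def beta (F : M → EuclideanSpace ℝ (Fin d)) (V' : (x : M) → TangentSpace (𝓡 m) x)
    (Φ Φ' : Flow ℝ M) (T : ℝ) : ℝ :=
  (hodgeNorm F V').toReal * √(maxTwoInfty m F Φ Φ' T).toReal

/-- `ε(t) = ‖F ∘ Φ^t - F ∘ Φ'^t‖_{L¹(ν; ℝ^d)}`, with the `ℓ¹` norm on `ℝ^d`. -/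
def orbitError (m : ℕ) [ChartedSpace (EuclideanSpace ℝ (Fin m)) M]
    (F : M → EuclideanSpace ℝ (Fin d)) (Φ Φ' : Flow ℝ M) (t : ℝ) : ℝ :=
  ∫ x, ∑ j : Fin d, |F (Φ t x) j - F (Φ' t x) j| ∂(ν[m, F])

end

end OrbitError

namespace OrbitError

open Filter Topology

/-! ### Linear algebra -/

/-! Write `u_j`, `v_j` for the coordinates of `F ∘ Φ^t`, `F ∘ Φ'^t` and `w_j = u_j - v_j`. By the
group law the time derivatives of `u_j` and `v_j` at `x` are `du_j(V)` and `dv_j(V')` at the same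
point `x`, so `∂_t w_j = du_j(V - V') + dw_j(V')`. The absolute value of a differentiable function
has a right derivative no larger than the absolute value of its derivative, and dominated
convergence carries this through the integral defining the error `ε`.

Since `df(W) = g(∇f, W)`, Cauchy–Schwarz bounds the first term by `‖∇u_j‖ ‖V - V'‖`, which sums to
at most `α`, and the second by `‖∇w_j‖ ‖V'‖`. Testing the weak Laplacian of `w_j` against `w_j`
itself gives `‖∇w_j‖² = ∫ w_j Δw_j ≤ ‖Δw_j‖_∞ ‖w_j‖₁` (`toReal_hodgeNorm_gradient_le`), and
Cauchy–Schwarz over `j` turns the second terms into `β √ε`. A comparison argument integrates `ε' ≤ α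
+ β √ε` from `ε(0) = 0`.

The geometric input is that `F` has injective differential, that gradients of `C¹` functions are
continuous and that the volume is finite. -/

theorem continuousAt_of_normal_equation {X E G : Type*} [TopologicalSpace X]
    [NormedAddCommGroup E] [InnerProductSpace ℝ E] [FiniteDimensional ℝ E]
    [NormedAddCommGroup G] [InnerProductSpace ℝ G] [CompleteSpace G]
    {A : X → E →L[ℝ] G} {b : X → E →L[ℝ] ℝ} {g : X → E} {x₀ : X}
    (hA : ContinuousAt A x₀) (hb : ContinuousAt b x₀)
    (hinj : ∀ᶠ x in 𝓝 x₀, Function.Injective (A x))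
    (hg : ∀ᶠ x in 𝓝 x₀, ∀ c, inner ℝ (A x (g x)) (A x c) = b x c) : ContinuousAt g x₀ := by
  have : CompleteSpace E := FiniteDimensional.complete ℝ E
  -- Normal equation: `g x = (A* A)⁻¹ A*`-type formula, here `S⁻¹` applied to the Riesz vector of `b
  -- x`. Injectivity of `A x` makes `S = A* A` invertible, and inversion is continuous at units.
  let S : X → E →L[ℝ] E := fun x => (ContinuousLinearMap.adjoint (A x)) ∘L (A x)
  have hS : ContinuousAt S x₀ :=
    ((ContinuousLinearMap.adjoint (𝕜 := ℝ) (E := E) (F := G)).continuous.continuousAt.comp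
      hA).clm_comp hA
  have hunit : ∀ᶠ x in 𝓝 x₀, IsUnit (S x) := by
    filter_upwards [hinj] with x hx
    have hSx : Function.Injective (S x) := by
      refine (injective_iff_map_eq_zero (S x)).2 fun v hv => ?_
      have h1 : inner ℝ (A x v) (A x v) = 0 := by
        rw [← ContinuousLinearMap.adjoint_inner_left]
        change inner ℝ (S x v) v = 0
        rw [hv, inner_zero_left]
      exact (injective_iff_map_eq_zero (A x)).1 hx v (inner_self_eq_zero.1 h1)
    exact ContinuousLinearMap.isUnit_iff_bijective.2
      ⟨hSx, LinearMap.surjective_of_injective (f := (S x).toLinearMap) hSx⟩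
  have hβ : ContinuousAt (fun x => (InnerProductSpace.toDual ℝ E).symm (b x)) x₀ :=
    (InnerProductSpace.toDual ℝ E).symm.continuous.continuousAt.comp hb
  have hinv : ContinuousAt (fun x => Ring.inverse (S x)) x₀ := by
    obtain ⟨u, hu⟩ := hunit.self_of_nhds
    have h1 := NormedRing.inverse_continuousAt u
    rw [hu] at h1
    exact ContinuousAt.comp (f := S) h1 hS
  refine (hinv.clm_apply hβ).congr ?_
  filter_upwards [hunit, hg] with x hx hgx
  have h1 : (InnerProductSpace.toDual ℝ E).symm (b x) = S x (g x) := by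
    refine ext_inner_right ℝ fun c => ?_
    rw [InnerProductSpace.toDual_symm_apply, ← hgx c]
    exact (ContinuousLinearMap.adjoint_inner_left (A x) c (A x (g x))).symm
  rw [h1, ← mul_apply_eq_comp, Ring.inverse_mul_cancel _ hx,
    one_apply_eq_self]

variable {m d : ℕ} {M : Type*} [TopologicalSpace M] [ChartedSpace (EuclideanSpace ℝ (Fin m)) M]

/-! ### Derivatives along vector fields -/

section Derivative

variable {G : Type*} [NormedAddCommGroup G] [NormedSpace ℝ G]

/-- The derivative of a vector valued function, as a linear map into the vector space itself. -/
noncomputable def vectorDifferential (f : M → G) (x : M) : TangentSpace (𝓡 m) x →L[ℝ] G :=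
  mfderiv (𝓡 m) 𝓘(ℝ, G) f x

variable [IsManifold (𝓡 m) 1 M] {f : M → G}

/-- `df(W)` is the fibre component of the tangent map of `f` along the section `W`, and the tangent
bundle of a vector space is a product. -/
theorem continuousWithinAt_vectorDifferential_apply (hf : ContMDiff (𝓡 m) 𝓘(ℝ, G) 1 f)
    {W : (x : M) → TangentSpace (𝓡 m) x} {s : Set M} {x : M}
    (hW : ContinuousWithinAt (fun x => (⟨x, W x⟩ : TangentBundle (𝓡 m) M)) s x) :
    ContinuousWithinAt (fun x => vectorDifferential f x (W x)) s x := by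
  have h1 := (hf.continuous_tangentMap le_rfl).continuousAt.comp_continuousWithinAt hW
  have h2 := (tangentBundleModelSpaceHomeomorph
    𝓘(ℝ, G)).continuous.continuousAt.comp_continuousWithinAt h1
  exact continuous_snd.continuousAt.comp_continuousWithinAt h2

theorem continuous_vectorDifferential_apply (hf : ContMDiff (𝓡 m) 𝓘(ℝ, G) 1 f)
    {W : (x : M) → TangentSpace (𝓡 m) x} (hW : IsContinuousField W) :
    Continuous (fun x => vectorDifferential f x (W x)) :=
  continuous_iff_continuousAt.2 fun _ => continuousWithinAt_univ _ _ |>.1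
    (continuousWithinAt_vectorDifferential_apply hf (Continuous.continuousWithinAt hW))

/-- In finite dimension, continuity of an operator-valued map can be tested on fixed vectors `c`; in
the trivialization such a `c` is a continuous local section. -/
theorem continuousAt_vectorDifferential_comp_symmL (hf : ContMDiff (𝓡 m) 𝓘(ℝ, G) 1 f) (x₀ : M) :
    ContinuousAt (fun x => (vectorDifferential f x) ∘L
      ((trivializationAt (EuclideanSpace ℝ (Fin m)) (TangentSpace (𝓡 m)) x₀).symmL ℝ x)) x₀ := by
  set e := trivializationAt (EuclideanSpace ℝ (Fin m)) (TangentSpace (𝓡 m) (M := M)) x₀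
  have hx₀ : x₀ ∈ e.baseSet := FiberBundle.mem_baseSet_trivializationAt' x₀
  rw [continuousAt_clm_apply]
  intro c
  have h1 : ContinuousOn (fun x => (⟨x, e.symmL ℝ x c⟩ : TangentBundle (𝓡 m) M)) e.baseSet := by
    have h := e.continuousOn_symm.comp (f := fun x : M => (x, c)) (s := e.baseSet) (by fun_prop)
      fun x hx => ⟨hx, mem_univ _⟩
    exact h.congr fun x hx => by rw [e.symmL_apply hx]; rfl
  exact (continuousWithinAt_vectorDifferential_apply hf (h1 x₀ hx₀)).continuousAt
    (e.open_baseSet.mem_nhds hx₀)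

end Derivative

/-! ### Embeddings -/

/-- In adapted charts `F` reads `u ↦ (u, 0)`. Projecting to the first factor gives a local left
inverse `R`, differentiable at `F x`, and the chain rule makes `dR` a left inverse of `dF`. -/
theorem injective_mfderiv_of_isImmersionAt {G : Type*} [NormedAddCommGroup G] [NormedSpace ℝ G]
    [IsManifold (𝓡 m) ∞ M] {F : M → G} {x : M} (h : IsImmersionAt (𝓡 m) 𝓘(ℝ, G) ∞ F x) :
    Function.Injective (mfderiv (𝓡 m) 𝓘(ℝ, G) F x) := by
  have h0 : (∞ : WithTop ℕ∞) ≠ 0 := by simp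
  let φ := h.domChart.extend (𝓡 m)
  let ψ := h.codChart.extend 𝓘(ℝ, G)
  let R : G → M := φ.symm ∘ (Prod.fst ∘ h.equiv.symm) ∘ ψ
  have hRF : R ∘ F =ᶠ[𝓝 x] id := by
    filter_upwards [h.domChart.open_source.mem_nhds h.mem_domChart_source] with y hy
    have hy' : φ y ∈ φ.target := φ.map_source (by simpa [φ] using hy)
    have h1 := h.writtenInCharts hy'
    have h2 : φ.symm (φ y) = y := h.domChart.extend_left_inv hy
    have h3 : ψ (F y) = h.equiv (φ y, 0) := by
      have h1' : ψ (F (φ.symm (φ y))) = h.equiv (φ y, 0) := h1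
      rwa [h2] at h1'
    change φ.symm ((h.equiv.symm (ψ (F y))).1) = y
    rw [h3, ContinuousLinearEquiv.symm_apply_apply, h2]
  have hF := h.contMDiffAt.mdifferentiableAt h0
  have hψ : MDifferentiableAt 𝓘(ℝ, G) 𝓘(ℝ, G) ψ (F x) :=
    (contMDiffAt_of_mem_maximalAtlas (n := ∞) h.codChart_mem_maximalAtlas
      h.mem_codChart_source).mdifferentiableAt h0
  have hxt : φ x ∈ φ.target := φ.map_source (by simpa [φ] using h.mem_domChart_source)
  have hval : (Prod.fst ∘ h.equiv.symm) (ψ (F x)) = φ x := by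
    have h1 := h.writtenInCharts hxt
    have h2 : φ.symm (φ x) = x := h.domChart.extend_left_inv h.mem_domChart_source
    have h1' : ψ (F (φ.symm (φ x))) = h.equiv (φ x, 0) := h1
    rw [h2] at h1'
    simp [h1']
  have hlin : MDifferentiableAt 𝓘(ℝ, G) 𝓘(ℝ, EuclideanSpace ℝ (Fin m))
      (Prod.fst ∘ h.equiv.symm) (ψ (F x)) :=
    (differentiableAt_fst.comp _ h.equiv.symm.differentiableAt).mdifferentiableAt
  have hφ : MDifferentiableAt 𝓘(ℝ, EuclideanSpace ℝ (Fin m)) (𝓡 m) φ.symm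
      ((Prod.fst ∘ h.equiv.symm) (ψ (F x))) := by
    rw [hval]
    have h1 := (contMDiffOn_extend_symm (I := 𝓡 m) h.domChart_mem_maximalAtlas)
    refine (h1.contMDiffAt ?_).mdifferentiableAt h0
    have : (𝓡 m) '' h.domChart.target = h.domChart.target := by simp
    rw [this]
    refine h.domChart.open_target.mem_nhds ?_
    simpa [φ] using hxt
  have hR : MDifferentiableAt 𝓘(ℝ, G) (𝓡 m) R (F x) :=
    MDifferentiableAt.comp (F x) hφ (MDifferentiableAt.comp (F x) hlin hψ)
  have key := (hR.hasMFDerivAt.comp x hF.hasMFDerivAt).congr_of_eventuallyEq hRF.symm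
  have key2 := hasMFDerivAt_unique key (hasMFDerivAt_id x)
  intro u v huv
  have h1 : ∀ w, mfderiv 𝓘(ℝ, G) (𝓡 m) R (F x) (mfderiv (𝓡 m) 𝓘(ℝ, G) F x w) = w := fun w =>
    congrArg (fun L => L w) key2
  rw [← h1 u, huv, h1]

variable [IsManifold (𝓡 m) ∞ M] {F : M → EuclideanSpace ℝ (Fin d)}

theorem injective_pushforward {F : M → EuclideanSpace ℝ (Fin d)}
    (hF : IsSmoothEmbedding (𝓡 m) 𝓘(ℝ, EuclideanSpace ℝ (Fin d)) ∞ F) (x : M) :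
    Function.Injective (pushforward (m := m) F x) :=
  injective_mfderiv_of_isImmersionAt (hF.isImmersion.isImmersionAt x)

/-- The gradient of a `C¹` function is continuous. -/
theorem continuous_pushforward_gradient
    (hF : IsSmoothEmbedding (𝓡 m) 𝓘(ℝ, EuclideanSpace ℝ (Fin d)) ∞ F)
    {f : M → ℝ} (hf : ContMDiff (𝓡 m) 𝓘(ℝ, ℝ) 1 f) :
    Continuous fun x => pushforward (m := m) F x (gradient F f x) := by
  have : IsManifold (𝓡 m) 1 M := IsManifold.of_le (n := ∞) (by simp)
  have hF1 : ContMDiff (𝓡 m) 𝓘(ℝ, EuclideanSpace ℝ (Fin d)) 1 F := hF.contMDiff.of_le (by simp)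
  rw [continuous_iff_continuousAt]
  intro x₀
  set e := trivializationAt (EuclideanSpace ℝ (Fin m)) (TangentSpace (𝓡 m) (M := M)) x₀ with he
  have hx₀ : x₀ ∈ e.baseSet := FiberBundle.mem_baseSet_trivializationAt' x₀
  -- Near `x₀` everything is read in the fixed model space, where the defining property of the
  -- gradient is the normal equation for `A` and `b`.
  let A : M → EuclideanSpace ℝ (Fin m) →L[ℝ] EuclideanSpace ℝ (Fin d) := fun x =>
    (pushforward F x) ∘L (e.symmL ℝ x)
  let b : M → EuclideanSpace ℝ (Fin m) →L[ℝ] ℝ := fun x => (differential f x) ∘L (e.symmL ℝ x)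
  let g : M → EuclideanSpace ℝ (Fin m) := fun x => e.continuousLinearMapAt ℝ x (gradient F f x)
  have hA : ContinuousAt A x₀ := continuousAt_vectorDifferential_comp_symmL hF1 x₀
  have hb : ContinuousAt b x₀ := continuousAt_vectorDifferential_comp_symmL hf x₀
  have hnhds : e.baseSet ∈ 𝓝 x₀ := e.open_baseSet.mem_nhds hx₀
  have hAg : ∀ x ∈ e.baseSet, A x (g x) = pushforward (m := m) F x (gradient F f x) := by
    intro x hx
    change pushforward F x (e.symmL ℝ x (e.continuousLinearMapAt ℝ x (gradient F f x))) = _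
    rw [e.symmL_continuousLinearMapAt hx]
  have hg : ContinuousAt g x₀ := by
    refine continuousAt_of_normal_equation hA hb ?_ ?_
    · filter_upwards [hnhds] with x hx
      refine (injective_pushforward hF x).comp ?_
      exact Function.LeftInverse.injective (g := e.continuousLinearMapAt ℝ x)
        (e.continuousLinearMapAt_symmL hx)
    · filter_upwards [hnhds] with x hx c
      rw [hAg x hx]
      exact metric_gradient F f x (injective_pushforward hF x) _
  refine (hA.clm_apply hg).congr ?_
  filter_upwards [hnhds] with x hx using hAg x hx

/-! ### Finiteness of the Riemannian volume. -/

omit [IsManifold (𝓡 m) ∞ M] in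
-- In a chart `F` is `C¹`, hence locally `K`-Lipschitz, and so multiplies `m`-dimensional Hausdorff
-- measure by at most `K ^ m`.
theorem exists_nhds_euclideanHausdorffMeasure_image_lt_top
    (hF : ContMDiff (𝓡 m) 𝓘(ℝ, EuclideanSpace ℝ (Fin d)) 1 F) (x : M) :
    ∃ s ∈ 𝓝 x, (μHE[m] : Measure (EuclideanSpace ℝ (Fin d))) (F '' s) < ⊤ := by
  let φ := chartAt (EuclideanSpace ℝ (Fin m)) x
  have h1 : ContDiffAt ℝ 1 (F ∘ φ.symm) (φ x) := by
    have h := (contMDiffAt_iff.1 (hF x)).2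
    simp only [mfld_simps] at h
    exact h.contDiffAt univ_mem
  obtain ⟨K, t, ht, hK⟩ := h1.exists_lipschitzOnWith
  have hxs : x ∈ φ.source := mem_chart_source _ x
  let t' := t ∩ Metric.ball (φ x) 1
  have ht' : t' ∈ 𝓝 (φ x) := Filter.inter_mem ht (Metric.ball_mem_nhds _ one_pos)
  refine ⟨φ.source ∩ φ ⁻¹' t', Filter.inter_mem (φ.open_source.mem_nhds hxs)
    ((φ.continuousAt hxs).preimage_mem_nhds ht'), ?_⟩
  have hsub : F '' (φ.source ∩ φ ⁻¹' t') ⊆ (F ∘ φ.symm) '' t' := by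
    rintro _ ⟨y, ⟨hy, hyt⟩, rfl⟩
    exact ⟨φ y, hyt, congrArg F (φ.left_inv hy)⟩
  refine (measure_mono hsub).trans_lt ?_
  have h2 := (hK.mono (inter_subset_left (t := Metric.ball (φ x) 1))).hausdorffMeasure_image_le
    (d := m) (Nat.cast_nonneg m)
  have h3 : (μHE[m] : Measure (EuclideanSpace ℝ (Fin m))) t' < ⊤ := by
    rw [EuclideanSpace.euclideanHausdorffMeasure_eq_volume]
    exact (measure_mono inter_subset_right).trans_lt measure_ball_lt_top
  -- The normalising factor depends only on `m`, so it is the same in the chart domain and in `ℝ^d`.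
  rw [Measure.euclideanHausdorffMeasure_def, Measure.smul_apply, ENNReal.smul_def, smul_eq_mul] at h3 ⊢
  calc _ ≤ _ := mul_le_mul_right h2 _
    _ = (K : ℝ≥0∞) ^ (m : ℝ) * _ := mul_left_comm _ _ _
    _ < ⊤ := ENNReal.mul_lt_top (by simp) h3

omit [IsManifold (𝓡 m) ∞ M] in
theorem isFiniteMeasure_riemannianVolume [CompactSpace M] [MeasurableSpace M] [BorelSpace M]
    (hF : IsSmoothEmbedding (𝓡 m) 𝓘(ℝ, EuclideanSpace ℝ (Fin d)) ∞ F) :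
    IsFiniteMeasure (riemannianVolume (m := m) F) := by
  have hme : MeasurableEmbedding F :=
    (Topology.IsClosedEmbedding.mk hF.isEmbedding
      (isCompact_range hF.contMDiff.continuous).isClosed).measurableEmbedding
  refine ⟨?_⟩
  rw [riemannianVolume]
  refine isCompact_univ.measure_lt_top_of_nhdsWithin fun x _ => ?_
  obtain ⟨s, hs, hlt⟩ := exists_nhds_euclideanHausdorffMeasure_image_lt_top
    (hF.contMDiff.of_le (by simp)) x
  refine ⟨s, by simpa using hs, ?_⟩
  rwa [hme.comap_apply]

end OrbitError

/-! ### Calculus lemmas -/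

namespace OrbitError

open Filter Topology

/-- The absolute value of a differentiable function has a right derivative. -/
theorem exists_hasDerivWithinAt_abs {f : ℝ → ℝ} {f' t : ℝ} (hf : HasDerivAt f f' t) :
    ∃ D : ℝ, |D| ≤ |f'| ∧ HasDerivWithinAt (fun s => |f s|) D (Ici t) t := by
  rcases lt_trichotomy (f t) 0 with h | h | h
  · exact ⟨-1 * f', by simp, ((hasDerivAt_abs_neg h).comp t hf).hasDerivWithinAt⟩
  -- At a zero of `f` the right slopes of `|f|` are the absolute values of those of `f`, as `s - t >
  -- 0`. A two-sided derivative may fail to exist here.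
  · refine ⟨|f'|, (abs_abs f').le, ?_⟩
    rw [← hasDerivWithinAt_Ioi_iff_Ici, hasDerivWithinAt_iff_tendsto_slope' self_notMem_Ioi]
    have h1 := (hasDerivWithinAt_iff_tendsto_slope' (s := Ioi t) self_notMem_Ioi).1
      hf.hasDerivWithinAt
    refine (h1.abs).congr' ?_
    filter_upwards [self_mem_nhdsWithin] with s hs
    have hs' : 0 < s - t := sub_pos.2 hs
    simp only [slope_def_field, h, abs_zero, sub_zero, abs_div, abs_of_pos hs']
  · exact ⟨1 * f', by simp, ((hasDerivAt_abs_pos h).comp t hf).hasDerivWithinAt⟩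

/-- Right differentiation under the integral sign. -/
theorem hasDerivWithinAt_Ici_integral {X : Type*} [MeasurableSpace X] {μ : Measure X}
    [IsFiniteMeasure μ] {g : ℝ → X → ℝ} {D : X → ℝ} {t C : ℝ} (hint : ∀ s, Integrable (g s) μ)
    (hlip : ∀ s x, |g s x - g t x| ≤ C * |s - t|)
    (hD : ∀ x, HasDerivWithinAt (fun s => g s x) (D x) (Ici t) t) :
    HasDerivWithinAt (fun s => ∫ x, g s x ∂μ) (∫ x, D x ∂μ) (Ici t) t := by
  rw [← hasDerivWithinAt_Ioi_iff_Ici, hasDerivWithinAt_iff_tendsto_slope' self_notMem_Ioi]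
  have h1 : ∀ x, Tendsto (fun s => (s - t)⁻¹ * (g s x - g t x)) (𝓝[>] t) (𝓝 (D x)) := fun x =>
    (hasDerivWithinAt_iff_tendsto_slope' self_notMem_Ioi).1 (hD x).Ioi_of_Ici
  have h2 : Tendsto (fun s => ∫ x, (s - t)⁻¹ * (g s x - g t x) ∂μ) (𝓝[>] t)
      (𝓝 (∫ x, D x ∂μ)) := by
    refine tendsto_integral_filter_of_dominated_convergence (fun _ => C)
      (Eventually.of_forall fun s =>
        (((hint s).sub (hint t)).const_mul (s - t)⁻¹).aestronglyMeasurable)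
      ?_ (integrable_const C) (Eventually.of_forall h1)
    filter_upwards [self_mem_nhdsWithin] with s hs
    refine Eventually.of_forall fun x => ?_
    have hs' : 0 < |s - t| := abs_pos.2 (sub_ne_zero.2 (ne_of_gt hs))
    rw [Real.norm_eq_abs, abs_mul, abs_inv, inv_mul_le_iff₀ hs', mul_comm]
    exact hlip s x
  refine h2.congr fun s => ?_
  rw [integral_const_mul, integral_sub (hint s) (hint t)]
  rfl

/-- The comparison principle for `y' ≤ α + β √y`, `y(0) = 0`. -/
theorem le_of_deriv_right_le_add_mul_sqrt {y : ℝ → ℝ} {α β T : ℝ} (hα : 0 ≤ α) (hβ : 0 ≤ β)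
    (hy₀ : y 0 = 0)
    (hy : ∀ t ∈ Icc (0 : ℝ) T, ContinuousWithinAt y (Icc 0 T) t)
    (hy' : ∀ t ∈ Icc (0 : ℝ) T, ∃ e, HasDerivWithinAt y e (Ici t) t ∧ e ≤ α + β * √(y t))
    {t : ℝ} (ht : t ∈ Icc (0 : ℝ) T) : y t ≤ t * (√α + β * √t / 2) ^ 2 := by
  -- Enlarging `α` to `a` makes the comparison function a strict supersolution; this avoids any
  -- uniqueness question at `y = 0`, where the square root is not Lipschitz.
  have key : ∀ a > α, y t ≤ t * (√a + β * √t / 2) ^ 2 := by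
    intro a ha
    have ha0 : 0 < a := hα.trans_lt ha
    choose! y' hyd hyl using hy'
    -- Expansion of `(√a √s + β s / 2) ^ 2` for `s ≥ 0`; in this form it is visibly differentiable
    -- at `0` too.
    let B : ℝ → ℝ := fun s => a * s + √a * β * s ^ (3 / 2 : ℝ) + β ^ 2 / 4 * s ^ 2
    have hpow : ∀ s : ℝ, 0 ≤ s → s ^ (3 / 2 : ℝ) = s * √s := by
      intro s hs
      rw [show (3 / 2 : ℝ) = 1 + 1 / 2 by norm_num, Real.rpow_add_of_nonneg hs (by norm_num)
        (by norm_num), Real.rpow_one, ← Real.sqrt_eq_rpow]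
    have hB : ∀ s : ℝ, 0 ≤ s → B s = (√a * √s + β * s / 2) ^ 2 := by
      intro s hs
      have h1 := Real.sq_sqrt ha0.le
      have h2 := Real.sq_sqrt hs
      simp only [B, hpow s hs]
      rw [add_sq, mul_pow, h1, h2]
      ring
    have hBd : ∀ s : ℝ, 0 ≤ s →
        HasDerivAt B (a + √a * β * (3 / 2 * √s) + β ^ 2 / 4 * (2 * s)) s := by
      intro s hs
      have h1 := Real.hasDerivAt_rpow_const (x := s) (p := 3 / 2) (Or.inr (by norm_num))
      rw [show (3 / 2 - 1 : ℝ) = 1 / 2 by norm_num, ← Real.sqrt_eq_rpow] at h1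
      have h2 := (((hasDerivAt_id s).const_mul a).add (h1.const_mul (√a * β))).add
        (((hasDerivAt_id s).pow 2).const_mul (β ^ 2 / 4))
      refine h2.congr_deriv ?_
      simp
    have h := image_le_of_deriv_right_lt_deriv_boundary' (f := y) (f' := y') (a := 0) (b := T)
      (B := B) (B' := fun s => a + √a * β * (3 / 2 * √s) + β ^ 2 / 4 * (2 * s)) hy
      (fun s hs => hyd s (Ico_subset_Icc_self hs)) (by simp [hy₀, B])
      (fun s hs => (hBd s hs.1).continuousAt.continuousWithinAt)
      (fun s hs => (hBd s hs.1).hasDerivWithinAt) ?_ ht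
    · rw [hB t ht.1] at h
      refine h.trans_eq ?_
      have h2 := Real.sq_sqrt ht.1
      calc (√a * √t + β * t / 2) ^ 2 = (√a * √t + β * (√t) ^ 2 / 2) ^ 2 := by rw [h2]
        _ = (√t) ^ 2 * (√a + β * √t / 2) ^ 2 := by ring
        _ = _ := by rw [h2]
    · intro s hs hys
      -- Where `y` touches `B`, the bound on `y'` is `α + β √a √s + β² s / 2`, while `B' = a + (3/2)
      -- β √a √s + β² s / 2` is strictly larger.
      have hsq : √(y s) = √a * √s + β * s / 2 := by
        rw [hys, hB s hs.1, Real.sqrt_sq]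
        have := hs.1
        positivity
      have h1 := hyl s (Ico_subset_Icc_self hs)
      rw [hsq] at h1
      have h2 : 0 ≤ √a * β * √s := by positivity
      nlinarith
  have hlim : Tendsto (fun a => t * (√a + β * √t / 2) ^ 2) (𝓝[>] α)
      (𝓝 (t * (√α + β * √t / 2) ^ 2)) := by
    have : Continuous fun a => t * (√a + β * √t / 2) ^ 2 := by fun_prop
    exact this.continuousAt.tendsto.mono_left nhdsWithin_le_nhds
  refine ge_of_tendsto hlim ?_
  filter_upwards [self_mem_nhdsWithin] with a ha using key a ha

/-- Cauchy–Schwarz twice: pointwise in `G`, then in `L²(μ)`. -/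
theorem integral_abs_inner_le {X G : Type*} [TopologicalSpace X] [CompactSpace X]
    [MeasurableSpace X] [BorelSpace X] {μ : Measure X} [IsFiniteMeasure μ] [NormedAddCommGroup G]
    [InnerProductSpace ℝ G] {p q : X → G} (hp : Continuous p) (hq : Continuous q) :
    ∫ x, |inner ℝ (p x) (q x)| ∂μ ≤ √(∫ x, ‖p x‖ ^ 2 ∂μ) * √(∫ x, ‖q x‖ ^ 2 ∂μ) := by
  have hmem : ∀ f : X → G, Continuous f → MemLp (fun x => ‖f x‖) (ENNReal.ofReal 2) μ := by
    intro f hf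
    obtain ⟨C, hC⟩ := isCompact_univ.exists_bound_of_continuousOn hf.norm.continuousOn
    exact MemLp.of_bound hf.norm.aestronglyMeasurable C
      (Eventually.of_forall fun x => hC x (mem_univ x))
  have h := integral_mul_le_Lp_mul_Lq_of_nonneg (μ := μ) (p := 2) (q := 2) (f := fun x => ‖p x‖)
    (g := fun x => ‖q x‖) Real.HolderConjugate.two_two
    (Eventually.of_forall fun x => norm_nonneg _) (Eventually.of_forall fun x => norm_nonneg _)
    (hmem p hp) (hmem q hq)
  simp only [Real.rpow_ofNat, ← Real.sqrt_eq_rpow] at h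
  refine le_trans ?_ h
  refine integral_mono_of_nonneg (Eventually.of_forall fun x => abs_nonneg _) ?_
    (Eventually.of_forall fun x => abs_real_inner_le_norm _ _)
  obtain ⟨C, hC⟩ := isCompact_univ.exists_bound_of_continuousOn (hp.norm.mul hq.norm).continuousOn
  exact Integrable.of_bound (hp.norm.mul hq.norm).aestronglyMeasurable C
    (Eventually.of_forall fun x => hC x (mem_univ x))

end OrbitError

namespace OrbitError

open Filter Topology

variable {m d : ℕ} {M : Type*} [TopologicalSpace M] [ChartedSpace (EuclideanSpace ℝ (Fin m)) M]

/-! ### Derivatives along flows -/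

section Flow

variable {G : Type*} [NormedAddCommGroup G] [NormedSpace ℝ G] {f : M → G}
  {W : (x : M) → TangentSpace (𝓡 m) x} {Φ : Flow ℝ M}

theorem Generates.hasDerivAt_comp (hΦ : Generates W Φ) (hf : ContMDiff (𝓡 m) 𝓘(ℝ, G) 1 f)
    (s : ℝ) (x : M) :
    HasDerivAt (fun s => f (Φ s x)) (vectorDifferential f (Φ s x) (W (Φ s x))) s := by
  have h1 := ((hf.mdifferentiable one_ne_zero) (Φ s x)).hasMFDerivAt.comp s (hΦ x s)
  have h2 : HasFDerivAt (fun s => f (Φ s x)) ((vectorDifferential f (Φ s x)) ∘L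
    ((1 : ℝ →L[ℝ] ℝ).smulRight (W (Φ s x)))) s := h1.hasFDerivAt
  refine h2.hasDerivAt.congr_deriv ?_
  rw [ContinuousLinearMap.comp_apply, ContinuousLinearMap.smulRight_apply, one_apply_eq_self,
    one_smul]

/-- The derivative of `f ∘ Φ^t` in `t`, expressed through the differential of `f ∘ Φ^t`. -/
theorem Generates.hasDerivAt_comp' (hΦ : Generates W Φ) {t : ℝ}
    (hf : ContMDiff (𝓡 m) 𝓘(ℝ, G) 1 fun x => f (Φ t x)) (x : M) :
    HasDerivAt (fun s => f (Φ s x)) (vectorDifferential (fun x => f (Φ t x)) x (W x)) t := by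
  -- Differentiate `f ∘ Φ^t` along the orbit at time `0` and shift time by `Φ^s = Φ^t ∘ Φ^{s - t}`;
  -- `f` itself need not be differentiable.
  have h1 := hΦ.hasDerivAt_comp hf 0 x
  -- The tangent space depends on the base point, so `Φ 0 x = x` is used through a free variable
  -- `y`.
  have h2 : ∀ y, y = x → vectorDifferential (fun x => f (Φ t x)) y (W y)
      = vectorDifferential (fun x => f (Φ t x)) x (W x) := by
    rintro _ rfl
    rfl
  rw [h2 _ (Φ.map_zero_apply x)] at h1
  have h3 := HasDerivAt.comp_sub_const t t (by rwa [sub_self])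
  refine h3.congr_of_eventuallyEq (Eventually.of_forall fun s => ?_)
  change f (Φ s x) = f (Φ t (Φ (s - t) x))
  rw [← Φ.map_add, add_sub_cancel]

theorem Generates.exists_lipschitz [IsManifold (𝓡 m) 1 M] [CompactSpace M] (hΦ : Generates W Φ)
    (hW : IsContinuousField W) (hf : ContMDiff (𝓡 m) 𝓘(ℝ, G) 1 f) :
    ∃ C, ∀ s t x, ‖f (Φ s x) - f (Φ t x)‖ ≤ C * |s - t| := by
  obtain ⟨C, hC⟩ := isCompact_univ.exists_bound_of_continuousOn
    (continuous_vectorDifferential_apply hf hW).continuousOn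
  refine ⟨C, fun s t x => ?_⟩
  exact convex_univ.norm_image_sub_le_of_norm_hasDerivWithin_le
    (f := fun s => f (Φ s x)) (fun r _ => (hΦ.hasDerivAt_comp hf r x).hasDerivWithinAt)
    (fun r _ => hC _ (mem_univ _)) (mem_univ t) (mem_univ s)

end Flow

/-- The pointwise time derivative of `F_j ∘ Φ^t - F_j ∘ Φ'^t`, split along `V - V'` and `V'`. -/
theorem hasDerivAt_sub_comp_flow {V V' : (x : M) → TangentSpace (𝓡 m) x} {Φ Φ' : Flow ℝ M}
    (hΦ : Generates V Φ) (hΦ' : Generates V' Φ') {f : M → ℝ} {t : ℝ}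
    (hu : ContMDiff (𝓡 m) 𝓘(ℝ, ℝ) 1 fun x => f (Φ t x))
    (hv : ContMDiff (𝓡 m) 𝓘(ℝ, ℝ) 1 fun x => f (Φ' t x)) (x : M) :
    HasDerivAt (fun s => f (Φ s x) - f (Φ' s x))
      (differential (fun x => f (Φ t x)) x ((V - V') x)
        + differential (fun x => f (Φ t x) - f (Φ' t x)) x (V' x)) t := by
  have h1 := (hΦ.hasDerivAt_comp' hu x).sub (hΦ'.hasDerivAt_comp' hv x)
  -- What remains is `du(V) - dv(V') = du(V - V') + d(u - v)(V')`.
  refine h1.congr_deriv ?_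
  have h2 : differential (fun x => f (Φ t x) - f (Φ' t x)) x
      = differential (m := m) (fun x => f (Φ t x)) x - differential (fun x => f (Φ' t x)) x :=
    ((hu.mdifferentiable one_ne_zero x).hasMFDerivAt.sub
      (hv.mdifferentiable one_ne_zero x).hasMFDerivAt).mfderiv
  rw [h2, sub_apply, Pi.sub_apply, map_sub]
  change differential (fun x => f (Φ t x)) x (V x) - differential (fun x => f (Φ' t x)) x (V' x) = _
  ring

/-! ### Estimates for the gradient -/

theorem continuous_pushforward_apply
    [IsManifold (𝓡 m) 1 M] {F : M → EuclideanSpace ℝ (Fin d)}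
    (hF : IsSmoothEmbedding (𝓡 m) 𝓘(ℝ, EuclideanSpace ℝ (Fin d)) ∞ F)
    {W : (x : M) → TangentSpace (𝓡 m) x} (hW : IsContinuousField W) :
    Continuous fun x => pushforward F x (W x) :=
  continuous_vectorDifferential_apply (hF.contMDiff.of_le (by simp)) hW

variable [MeasurableSpace M] {F : M → EuclideanSpace ℝ (Fin d)}

/-- Only the pushforward is required to be continuous, so that gradients are covered as well as the
given fields. -/
theorem toReal_hodgeNorm [BorelSpace M] {W : (x : M) → TangentSpace (𝓡 m) x}
    (hW : Continuous fun x => pushforward F x (W x)) :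
    (hodgeNorm F W).toReal = √(∫ x, ‖pushforward F x (W x)‖ ^ 2 ∂(riemannianVolume (m := m) F)) := by
  rw [integral_eq_lintegral_of_nonneg_ae (Eventually.of_forall fun x => sq_nonneg _)
    (hW.norm.pow 2).aestronglyMeasurable, Real.sqrt_eq_rpow, ENNReal.toReal_rpow, hodgeNorm]
  simp only [metric, real_inner_self_eq_norm_sq]

variable [IsManifold (𝓡 m) ∞ M] [CompactSpace M] [BorelSpace M]

/-- `df(W) = g(∇f, W)` is an inner product of pushforwards in `ℝ^d`, to which Cauchy–Schwarz
applies. -/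
theorem integral_abs_differential_le
    (hF : IsSmoothEmbedding (𝓡 m) 𝓘(ℝ, EuclideanSpace ℝ (Fin d)) ∞ F)
    {f : M → ℝ} (hf : ContMDiff (𝓡 m) 𝓘(ℝ, ℝ) 1 f) {W : (x : M) → TangentSpace (𝓡 m) x}
    (hW : Continuous fun x => pushforward F x (W x)) :
    ∫ x, |differential f x (W x)| ∂(riemannianVolume (m := m) F)
      ≤ (hodgeNorm (m := m) F (gradient F f)).toReal * (hodgeNorm F W).toReal := by
  have := isFiniteMeasure_riemannianVolume hF
  have hg := continuous_pushforward_gradient hF hf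
  rw [toReal_hodgeNorm hg, toReal_hodgeNorm hW]
  refine le_of_eq_of_le ?_ (integral_abs_inner_le hg hW)
  refine integral_congr_ae (Eventually.of_forall fun x => ?_)
  exact congrArg abs (metric_gradient F f x (injective_pushforward hF x) (W x)).symm

omit [IsManifold (𝓡 m) ∞ M] in
theorem integrable_of_continuous
    (hF : IsSmoothEmbedding (𝓡 m) 𝓘(ℝ, EuclideanSpace ℝ (Fin d)) ∞ F)
    {f : M → ℝ} (hf : Continuous f) : Integrable f (riemannianVolume (m := m) F) := by
  have := isFiniteMeasure_riemannianVolume hF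
  obtain ⟨C, hC⟩ := isCompact_univ.exists_bound_of_continuousOn hf.continuousOn
  exact Integrable.of_bound hf.aestronglyMeasurable C
    (Eventually.of_forall fun x => hC x (mem_univ x))

/-- `‖∇f‖_ℍ² = ∫ f Δf dν ≤ ‖Δf‖_∞ ‖f‖₁`. -/
theorem toReal_hodgeNorm_gradient_le
    (hF : IsSmoothEmbedding (𝓡 m) 𝓘(ℝ, EuclideanSpace ℝ (Fin d)) ∞ F)
    {f : M → ℝ} (hf : ContMDiff (𝓡 m) 𝓘(ℝ, ℝ) 1 f) (hL : laplacianSupNorm m F f ≠ ⊤) :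
    (hodgeNorm (m := m) F (gradient F f)).toReal
      ≤ √(laplacianSupNorm m F f).toReal * √(∫ x, |f x| ∂(riemannianVolume (m := m) F)) := by
  rw [toReal_hodgeNorm (continuous_pushforward_gradient hF hf), ← Real.sqrt_mul (by positivity)]
  refine Real.sqrt_le_sqrt ?_
  set L := laplacianSupNorm m F f with hLdef
  have hfi := (integrable_of_continuous (m := m) hF hf.continuous.abs)
  -- The norm is an infimum over weak Laplacians; any `c` above it admits one with norm below `c`,
  -- so uniqueness and attainment are not needed.
  have key : ∀ c > L.toReal, ∫ x, ‖pushforward F x (gradient (m := m) F f x)‖ ^ 2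
      ∂(riemannianVolume (m := m) F) ≤ c * ∫ x, |f x| ∂(riemannianVolume (m := m) F) := by
    intro c hc
    have hlt : L < ENNReal.ofReal c := (ENNReal.lt_ofReal_iff_toReal_lt hL).2 hc
    rw [hLdef, laplacianSupNorm] at hlt
    simp only [iInf_lt_iff] at hlt
    obtain ⟨h, hh, hlt⟩ := hlt
    -- The weak equation is tested with `f` itself, giving `∫ f h = ∫ g(∇f, ∇f)`.
    have h1 := hh.2.2 f hf
    simp only [mul_neg, integral_neg, neg_inj, metric, real_inner_self_eq_norm_sq] at h1
    rw [← h1, ← integral_const_mul]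
    have hb : ∀ᵐ x ∂(riemannianVolume (m := m) F), ‖h x‖ ≤ c := by
      have h2 := ae_le_eLpNormEssSup (f := h) (μ := riemannianVolume (m := m) F)
      rw [eLpNorm_exponent_top] at hlt
      filter_upwards [h2] with x hx
      have h3 := hx.trans_lt hlt
      rw [← ofReal_norm] at h3
      exact (ENNReal.ofReal_lt_ofReal_iff'.1 h3).1.le
    refine (Real.le_norm_self _).trans (norm_integral_le_of_norm_le (hfi.const_mul c) ?_)
    filter_upwards [hb] with x hx
    rw [norm_mul, Real.norm_eq_abs, mul_comm]
    exact mul_le_mul_of_nonneg_right hx (abs_nonneg _)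
  have hlim : Tendsto (fun c => c * ∫ x, |f x| ∂(riemannianVolume (m := m) F)) (𝓝[>] L.toReal)
      (𝓝 (L.toReal * ∫ x, |f x| ∂(riemannianVolume (m := m) F))) :=
    (continuous_mul_const _).continuousAt.tendsto.mono_left nhdsWithin_le_nhds
  refine ge_of_tendsto hlim ?_
  filter_upwards [self_mem_nhdsWithin] with c hc using key c hc

end OrbitError

/-! ### The differential inequality for the orbit error. -/

namespace OrbitError

open Filter Topology

variable {m d : ℕ} {M : Type*} [TopologicalSpace M] [ChartedSpace (EuclideanSpace ℝ (Fin m)) M]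
  [IsManifold (𝓡 m) ∞ M]

omit [IsManifold (𝓡 m) ∞ M] in
theorem contMDiff_coord {f : M → EuclideanSpace ℝ (Fin d)}
    (hf : ContMDiff (𝓡 m) 𝓘(ℝ, EuclideanSpace ℝ (Fin d)) 1 f) (j : Fin d) :
    ContMDiff (𝓡 m) 𝓘(ℝ, ℝ) 1 fun x => f x j :=
  (EuclideanSpace.proj (𝕜 := ℝ) j).contMDiff.comp hf

omit [IsManifold (𝓡 m) ∞ M] in
theorem continuous_uncurry_sum_abs_sub {F : M → EuclideanSpace ℝ (Fin d)} (hF : Continuous F)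
    (Φ Φ' : Flow ℝ M) :
    Continuous (Function.uncurry fun s x => ∑ j, |F (Φ s x) j - F (Φ' s x) j|) := by
  have h1 : Continuous fun p : ℝ × M => F (Φ p.1 p.2) := hF.comp Φ.cont'
  have h2 : Continuous fun p : ℝ × M => F (Φ' p.1 p.2) := hF.comp Φ'.cont'
  unfold Function.uncurry
  fun_prop

omit [IsManifold (𝓡 m) ∞ M] in
theorem orbitError_zero [MeasurableSpace M] {F : M → EuclideanSpace ℝ (Fin d)}
    {Φ Φ' : Flow ℝ M} : orbitError m F Φ Φ' 0 = 0 := by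
  simp [orbitError]

variable [CompactSpace M] [MeasurableSpace M] [BorelSpace M]
  {F : M → EuclideanSpace ℝ (Fin d)} {V V' : (x : M) → TangentSpace (𝓡 m) x} {Φ Φ' : Flow ℝ M}
  {T t : ℝ}

omit [IsManifold (𝓡 m) ∞ M] [CompactSpace M] [BorelSpace M] in
theorem sum_toReal_hodgeNorm_gradient_le (hα : maxOneTwo m F Φ T ≠ ⊤) (ht : t ∈ Icc 0 T) :
    ∑ j, (hodgeNorm (m := m) F (gradient F (fun x => F (Φ t x) j))).toReal
      ≤ (maxOneTwo m F Φ T).toReal := by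
  have h1 : seminormOneTwo m F (fun x => F (Φ t x)) ≤ maxOneTwo m F Φ T :=
    le_iSup₂ (f := fun t (_ : t ∈ Icc (0 : ℝ) T) => seminormOneTwo m F (fun x => F (Φ t x))) t ht
  have h2 := ENNReal.sum_ne_top.1 (ne_top_of_le_ne_top hα h1)
  rw [← ENNReal.toReal_sum h2]
  exact ENNReal.toReal_mono hα h1

theorem sum_toReal_hodgeNorm_gradient_sub_le
    (hF : IsSmoothEmbedding (𝓡 m) 𝓘(ℝ, EuclideanSpace ℝ (Fin d)) ∞ F)
    (hβ : maxTwoInfty m F Φ Φ' T ≠ ⊤) (ht : t ∈ Icc 0 T)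
    (hu : ContMDiff (𝓡 m) 𝓘(ℝ, EuclideanSpace ℝ (Fin d)) 1 fun x => F (Φ t x))
    (hv : ContMDiff (𝓡 m) 𝓘(ℝ, EuclideanSpace ℝ (Fin d)) 1 fun x => F (Φ' t x)) :
    ∑ j, (hodgeNorm (m := m) F (gradient F (fun x => F (Φ t x) j - F (Φ' t x) j))).toReal
      ≤ √(maxTwoInfty m F Φ Φ' T).toReal * √(orbitError m F Φ Φ' t) := by
  have h1 : seminormTwoInfty m F (fun x => F (Φ t x) - F (Φ' t x)) ≤ maxTwoInfty m F Φ Φ' T :=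
    le_iSup₂ (f := fun t (_ : t ∈ Icc (0 : ℝ) T) =>
      seminormTwoInfty m F (fun x => F (Φ t x) - F (Φ' t x))) t ht
  have h2 := ENNReal.sum_ne_top.1 (ne_top_of_le_ne_top hβ h1)
  have hw : ∀ j, ContMDiff (𝓡 m) 𝓘(ℝ, ℝ) 1 fun x => F (Φ t x) j - F (Φ' t x) j := fun j =>
    (contMDiff_coord hu j).sub (contMDiff_coord hv j)
  refine (Finset.sum_le_sum fun j hj =>
    toReal_hodgeNorm_gradient_le hF (hw j) (h2 j hj)).trans ?_
  -- Cauchy–Schwarz over the coordinates: `∑ √(a_j) √(b_j) ≤ √(∑ a_j) √(∑ b_j)`.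
  refine (Real.sum_sqrt_mul_sqrt_le _ (fun _ => ENNReal.toReal_nonneg)
    (fun _ => integral_nonneg fun _ => abs_nonneg _)).trans ?_
  refine mul_le_mul (Real.sqrt_le_sqrt ?_) (Real.sqrt_le_sqrt ?_) (Real.sqrt_nonneg _)
    (Real.sqrt_nonneg _)
  · refine le_trans (le_of_eq ?_) (ENNReal.toReal_mono hβ h1)
    exact (ENNReal.toReal_sum h2).symm
  · rw [orbitError, integral_finsetSum _ fun j _ => integrable_of_continuous hF
      (hw j).continuous.abs]

omit [IsManifold (𝓡 m) ∞ M] in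
theorem continuous_orbitError
    (hF : IsSmoothEmbedding (𝓡 m) 𝓘(ℝ, EuclideanSpace ℝ (Fin d)) ∞ F) :
    Continuous (orbitError m F Φ Φ') := by
  have := isFiniteMeasure_riemannianVolume hF
  have h := continuous_parametric_integral_of_continuous (μ := riemannianVolume (m := m) F)
    (continuous_uncurry_sum_abs_sub hF.contMDiff.continuous Φ Φ') isCompact_univ
  simp only [setIntegral_univ] at h
  exact h

/-- The `L¹` error of the flows has a right derivative. -/
theorem exists_hasDerivWithinAt_orbitError
    (hF : IsSmoothEmbedding (𝓡 m) 𝓘(ℝ, EuclideanSpace ℝ (Fin d)) ∞ F)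
    (hV : IsContinuousField V) (hV' : IsContinuousField V')
    (hΦ : Generates V Φ) (hΦ' : Generates V' Φ')
    (hu : ContMDiff (𝓡 m) 𝓘(ℝ, EuclideanSpace ℝ (Fin d)) 1 fun x => F (Φ t x))
    (hv : ContMDiff (𝓡 m) 𝓘(ℝ, EuclideanSpace ℝ (Fin d)) 1 fun x => F (Φ' t x))
    (hα : maxOneTwo m F Φ T ≠ ⊤) (hβ : maxTwoInfty m F Φ Φ' T ≠ ⊤) (ht : t ∈ Icc 0 T) :
    ∃ e, HasDerivWithinAt (orbitError m F Φ Φ') e (Ici t) t ∧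
      e ≤ alpha F V V' Φ T + beta F V' Φ Φ' T * √(orbitError m F Φ Φ' t) := by
  have : IsManifold (𝓡 m) 1 M := IsManifold.of_le (n := ∞) (by simp)
  have := isFiniteMeasure_riemannianVolume hF
  have hF1 : ContMDiff (𝓡 m) 𝓘(ℝ, EuclideanSpace ℝ (Fin d)) 1 F := hF.contMDiff.of_le (by simp)
  let a : Fin d → M → ℝ := fun j x => differential (fun x => F (Φ t x) j) x ((V - V') x)
  let b : Fin d → M → ℝ := fun j x =>
    differential (fun x => F (Φ t x) j - F (Φ' t x) j) x (V' x)
  have hder : ∀ j x, HasDerivAt (fun s => F (Φ s x) j - F (Φ' s x) j) (a j x + b j x) t :=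
    fun j x => hasDerivAt_sub_comp_flow (f := fun x => F x j) hΦ hΦ' (contMDiff_coord hu j)
      (contMDiff_coord hv j) x
  choose D hDle hD using fun j x => exists_hasDerivWithinAt_abs (hder j x)
  -- These bounds use smoothness of `F` only, so they hold for all times, including those beyond `T`
  -- that a right derivative at `T` involves.
  obtain ⟨C, hC⟩ := hΦ.exists_lipschitz hV hF1
  obtain ⟨C', hC'⟩ := hΦ'.exists_lipschitz hV' hF1
  have hcont : ∀ s, Continuous fun x => ∑ j, |F (Φ s x) j - F (Φ' s x) j| := fun s => by
    exact (continuous_uncurry_sum_abs_sub hF1.continuous Φ Φ').comp (Continuous.prodMk_right s)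
  have hlip : ∀ s x, |(∑ j, |F (Φ s x) j - F (Φ' s x) j|) - (∑ j, |F (Φ t x) j - F (Φ' t x) j|)|
      ≤ (d * (C + C')) * |s - t| := by
    intro s x
    rw [← Finset.sum_sub_distrib]
    refine (Finset.abs_sum_le_sum_abs _ _).trans ?_
    have h1 : ∀ j ∈ (Finset.univ : Finset (Fin d)),
        |(|F (Φ s x) j - F (Φ' s x) j| - |F (Φ t x) j - F (Φ' t x) j|)|
          ≤ (C + C') * |s - t| := by
      intro j _
      refine (abs_abs_sub_abs_le_abs_sub _ _).trans ?_
      rw [sub_sub_sub_comm]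
      refine (abs_sub _ _).trans ?_
      rw [add_mul]
      exact add_le_add ((PiLp.norm_apply_le (F (Φ s x) - F (Φ t x)) j).trans (hC s t x))
        ((PiLp.norm_apply_le (F (Φ' s x) - F (Φ' t x)) j).trans (hC' s t x))
    refine (Finset.sum_le_card_nsmul _ _ _ h1).trans_eq ?_
    rw [Finset.card_univ, Fintype.card_fin, nsmul_eq_mul, mul_assoc]
  refine ⟨∫ x, ∑ j, D j x ∂(riemannianVolume (m := m) F),
    hasDerivWithinAt_Ici_integral (fun s => integrable_of_continuous hF (hcont s)) hlip
      fun x => HasDerivWithinAt.fun_sum fun j _ => hD j x, ?_⟩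
  have hcV : Continuous fun x => pushforward F x ((V - V') x) := by
    have h := (continuous_pushforward_apply hF hV).sub (continuous_pushforward_apply hF hV')
    exact h.congr fun x => (map_sub (pushforward F x) (V x) (V' x)).symm
  have hcV' := continuous_pushforward_apply hF hV'
  have hw : ∀ j, ContMDiff (𝓡 m) 𝓘(ℝ, ℝ) 1 fun x => F (Φ t x) j - F (Φ' t x) j := fun j =>
    (contMDiff_coord hu j).sub (contMDiff_coord hv j)
  have hc₁ : ∀ j, Continuous (a j) := fun j => by
    have h1 := continuous_vectorDifferential_apply (contMDiff_coord hu j) hV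
    have h2 := continuous_vectorDifferential_apply (contMDiff_coord hu j) hV'
    exact (h1.sub h2).congr fun x =>
      (map_sub (differential (fun x => F (Φ t x) j) x) (V x) (V' x)).symm
  have hc₂ : ∀ j, Continuous (b j) := fun j =>
    continuous_vectorDifferential_apply (hw j) hV'
  have hi₁ := fun j => integrable_of_continuous (m := m) hF (hc₁ j).abs
  have hi₂ := fun j => integrable_of_continuous (m := m) hF (hc₂ j).abs
  have hbound : ∫ x, ∑ j, D j x ∂(riemannianVolume (m := m) F)
      ≤ ∑ j, (∫ x, |a j x| ∂(riemannianVolume (m := m) F)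
        + ∫ x, |b j x| ∂(riemannianVolume (m := m) F)) := by
    calc _ ≤ ∫ x, ∑ j, (|a j x| + |b j x|) ∂(riemannianVolume (m := m) F) := by
          -- Only the dominating function has to be integrable; nothing is asked of `D`.
          refine (Real.le_norm_self _).trans (norm_integral_le_of_norm_le
            (integrable_finsetSum _ fun j _ => (hi₁ j).add (hi₂ j))
            (Eventually.of_forall fun x => ?_))
          refine (Finset.abs_sum_le_sum_abs _ _).trans (Finset.sum_le_sum fun j _ => ?_)
          exact (hDle j x).trans (abs_add_le _ _)
      _ = _ := by
          refine (integral_finsetSum _ fun j _ => (hi₁ j).add (hi₂ j)).trans ?_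
          exact Finset.sum_congr rfl fun j _ => integral_add (hi₁ j) (hi₂ j)
  refine hbound.trans ?_
  rw [Finset.sum_add_distrib]
  refine add_le_add ?_ ?_
  · refine (Finset.sum_le_sum fun j _ =>
      integral_abs_differential_le hF (contMDiff_coord hu j) hcV).trans ?_
    rw [← Finset.sum_mul, mul_comm]
    exact mul_le_mul_of_nonneg_left (sum_toReal_hodgeNorm_gradient_le hα ht)
      ENNReal.toReal_nonneg
  · refine (Finset.sum_le_sum fun j _ =>
      integral_abs_differential_le hF (hw j) hcV').trans ?_
    rw [← Finset.sum_mul, mul_comm, beta, mul_assoc]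
    exact mul_le_mul_of_nonneg_left
      (sum_toReal_hodgeNorm_gradient_sub_le hF hβ ht hu hv) ENNReal.toReal_nonneg

end OrbitError

theorem proposition5p6 {m d : ℕ} {M : Type*} [TopologicalSpace M] [T2Space M] [CompactSpace M]
    [ChartedSpace (EuclideanSpace ℝ (Fin m)) M] [IsManifold (𝓡 m) ∞ M]
    [MeasurableSpace M] [BorelSpace M]
    (F : M → EuclideanSpace ℝ (Fin d))
    (hF : IsSmoothEmbedding (𝓡 m) 𝓘(ℝ, EuclideanSpace ℝ (Fin d)) ∞ F)
    (V V' : (x : M) → TangentSpace (𝓡 m) x)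
    (hV : OrbitError.IsContinuousField V) (hV' : OrbitError.IsContinuousField V')
    (Φ Φ' : Flow ℝ M)
    (hΦ : OrbitError.Generates V Φ) (hΦ' : OrbitError.Generates V' Φ')
    (T : ℝ) (hT : 0 < T)
    (hC : ∀ t ∈ Icc (0 : ℝ) T,
      ContMDiff (𝓡 m) 𝓘(ℝ, EuclideanSpace ℝ (Fin d)) 1 (fun x => F (Φ t x)))
    (hC' : ∀ t ∈ Icc (0 : ℝ) T,
      ContMDiff (𝓡 m) 𝓘(ℝ, EuclideanSpace ℝ (Fin d)) 1 (fun x => F (Φ' t x)))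
    (hα : OrbitError.maxOneTwo m F Φ T ≠ ⊤)
    (hβ : OrbitError.maxTwoInfty m F Φ Φ' T ≠ ⊤) :
    ∀ t ∈ Icc (0 : ℝ) T,
      (∃ e : ℝ, HasDerivWithinAt (OrbitError.orbitError m F Φ Φ') e (Ici t) t ∧
        e ≤ OrbitError.alpha F V V' Φ T
          + OrbitError.beta F V' Φ Φ' T * √(OrbitError.orbitError m F Φ Φ' t)) ∧
      OrbitError.orbitError m F Φ Φ' t
        ≤ t * (√(OrbitError.alpha F V V' Φ T)
          + OrbitError.beta F V' Φ Φ' T * √t / 2) ^ 2 := by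
  have hderiv : ∀ t ∈ Icc (0 : ℝ) T, ∃ e : ℝ,
      HasDerivWithinAt (OrbitError.orbitError m F Φ Φ') e (Ici t) t ∧
        e ≤ OrbitError.alpha F V V' Φ T
          + OrbitError.beta F V' Φ Φ' T * √(OrbitError.orbitError m F Φ Φ' t) := fun t ht =>
    OrbitError.exists_hasDerivWithinAt_orbitError hF hV hV' hΦ hΦ' (hC t ht) (hC' t ht) hα hβ ht
  refine fun t ht => ⟨hderiv t ht, ?_⟩
  exact OrbitError.le_of_deriv_right_le_add_mul_sqrt
    (mul_nonneg ENNReal.toReal_nonneg ENNReal.toReal_nonneg)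
    (mul_nonneg ENNReal.toReal_nonneg (Real.sqrt_nonneg _)) OrbitError.orbitError_zero
    (OrbitError.continuous_orbitError hF).continuousOn hderiv ht
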